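/- **Model.** A dynamic graph on a static set $V$ of $n$ anonymous nodes is a sequence $\mathcal G_0,\mathcal G_1,\dots$ of simple undirected graphs on $V$; in every round $r$ the edges at each node $v$ carry pairwise distinct port labels $0,\dots,\deg_r(v)-1$, with no relation between the two labels of an edge or between rounds. It is *$T$-Path Connected* ($T\ge 1$) if for all $r\ge 0$ and all $u,v\in V$ there is a round $i\in[r,r+T-1]$ in which $u$ and $v$ lie in the same connected component of $\mathcal G_i$. There are $k$ agents, $1\le k\le n$, with IDs $1,\dots,k$, initially placed arbitrarily. A *hole* is a node without agents, a *multinode* a node with at least two agents. Rounds are synchronous. In a round, each non-terminated agent sees the IDs of the agents at its node and, for each port, those at the corresponding neighbour, as well as the adjacencies between these neighbours (1-hop visibility); it receives all messages broadcast by non-terminated agents in its connected component of $\mathcal G_r$ (global communication); then it updates its memory and stays or moves through a port. Agents know $T$ and their own ID, but not $n$ or $k$. *Explicit dispersion* is solved if no agent terminates before every node contains at most one agent, and eventually all agents have terminated with every node containing at most one agent. The running time is the number of rounds until the last agent terminates. Memory is the number of bits an agent keeps between rounds. **Algorithm.** Each agent $a$ stores its ID, $T$, a counter $t$ (initially $0$)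 and a termination flag. In each round the minimum-ID agent at each occupied node broadcasts its ID, the number of agents at its node, and its 1-hop information. An agent that is at a multinode or receives a message from a multinode sets $t:=0$; if moreover it sees a hole or receives information about one, then it evaluates a sliding rule on the received messages and, if it is one of the agents on the resulting path, moves along its port of the path. Any other agent stays. An agent that knows of no multinode in the round sets $t:=t+1$, stays, and terminates if $t=T$. A *sliding path* is a sequence $(b_1,q_1),\dots,(b_l,q_l)$ with distinct $b_j$ such that $b_1$ is the minimum ID among the agents broadcasting from multinodes, port $q_j$ at the node of $b_j$ leads to a node whose minimum-ID agent is $b_{j+1}$ ($j<l$), and port $q_l$ at the node of $b_l$ leads to a hole. A *sliding rule* (the sliding step of the algorithm $\mathcal{DISP}$) is a function of the list of received messages that returns a sliding path whenever these messages contain one. **Theorem.** The rule that selects, by breadth-first search, a shortest sliding path (ties broken by port numbers) is a sliding rule. Moreover there are absolute constants $c,C,D>0$ such that for every sliding rule, all $1\le k\le n$ and all $T\ge1$: 1. on every $T$-Path Connected dynamic graph with $n$ nodes and from every initial placement of the $k$ agents, the algorithm with that sliding rule solves explicit dispersion, all agents have terminated after at most $C\,k\,T$ rounds, and each agent uses at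 most $D\log_2\max(2,k,T)$ bits of memory at all times; 2. there are a $T$-Path Connected dynamic graph with $n$ nodes and an initial placement of the $k$ agents for which the algorithm with that sliding rule runs for at least $c\,k\,T$ rounds before all agents have terminated. That is, the algorithm solves explicit dispersion in $\Theta(k\cdot T)$ rounds in the worst case, with $O(\log\max(k,T))$ bits per agent. -/

import Mathlib

/-! ## Port-labelled dynamic graphs -/

/-- An undirected graph in which the edges at each node `v` carry the port labels
`0, …, deg v - 1`. Nodes are anonymous to the agents, and the two labels of an edge are
unrelated. The bijection `port v` forces `deg v` to be the degree of `v`. -/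
structure PortGraph (V : Type) where
  graph : SimpleGraph V
  deg : V → ℕ
  port : (v : V) → Fin (deg v) ≃ graph.neighborSet v

/-- A dynamic graph on the static node set `V`: one port-labelled graph for every round. -/
abbrev DynamicGraph (V : Type) : Type := ℕ → PortGraph V

/-- `T`-Path Connectivity: in every window `r, …, r + T - 1` of `T` consecutive rounds, any two
nodes lie in a common connected component in at least one round. -/
def TPathConnected {V : Type} (G : DynamicGraph V) (T : ℕ) : Prop :=
  ∀ (r : ℕ) (u v : V), ∃ i : ℕ, r ≤ i ∧ i < r + T ∧ (G i).graph.Reachable u v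

/-! ## Synchronous agents with 1-hop visibility and global communication -/

/-- What an agent sees in a round: the IDs of the agents at its own node, for every port (the
position in the list) the IDs of the agents at the neighbour behind that port (`∅` for a hole), and
which of these neighbours are adjacent to each other. -/
structure View where
  here : Finset ℕ
  nbr : List (Finset ℕ)
  adj : ℕ → ℕ → Prop

/-- A deterministic algorithm for the agents. An agent is started with its ID and with `T`.
In a round it may broadcast a message, and it then computes, from its memory, its view and the
messages received, its new memory and the port to leave through (`none`: stay). -/
structure AgentAlgorithm (State Msg : Type) where
  init : (ID T : ℕ) → State
  broadcast : State → View → Option Msg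
  compute : State → View → List Msg → State × Option ℕ
  terminated : State → Prop

/-- Positions and memory contents of the `k` agents on `n` nodes at the start of a round. -/
structure Config (State : Type) (n k : ℕ) where
  pos : Fin k → Fin n
  state : Fin k → State

/-- The agents have the IDs `1, …, k`. -/
def agentID {k : ℕ} (i : Fin k) : ℕ := i.val + 1

namespace Config

variable {State : Type} {n k : ℕ}

/-- The IDs of the agents at the node `v`. -/
def idsAt (c : Config State n k) (v : Fin n) : Finset ℕ :=
  (Finset.univ.filter fun i => c.pos i = v).image agentID

/-- The view of an agent at the node `v` when the current graph is `H`. -/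
def view (c : Config State n k) (H : PortGraph (Fin n)) (v : Fin n) : View where
  here := c.idsAt v
  nbr := List.ofFn fun p : Fin (H.deg v) => c.idsAt (H.port v p)
  adj := fun p q => ∃ (hp : p < H.deg v) (hq : q < H.deg v),
    H.graph.Adj (H.port v ⟨p, hp⟩) (H.port v ⟨q, hq⟩)

/-- Every node contains at most one agent. -/
def Dispersed (c : Config State n k) : Prop := Function.Injective c.pos

/-- All agents have terminated. -/
def AllTerminated {Msg : Type} (A : AgentAlgorithm State Msg) (c : Config State n k) : Prop :=
  ∀ i, A.terminated (c.state i)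

end Config

namespace AgentAlgorithm

variable {State Msg : Type} {n k : ℕ}

open Classical in
/-- Global communication: the agent `i` gets, in the order of the senders' IDs, the messages of all
agents (itself included) that have not terminated and are in its connected component of `H`. -/
noncomputable def inbox (A : AgentAlgorithm State Msg) (H : PortGraph (Fin n))
    (c : Config State n k) (i : Fin k) : List Msg :=
  (List.finRange k).filterMap fun j =>
    if ¬ A.terminated (c.state j) ∧ H.graph.Reachable (c.pos i) (c.pos j) then
      A.broadcast (c.state j) (c.view H (c.pos j))
    else none

/-- The result of the Communicate and Compute phases for the agent `i`. -/
noncomputable def decision (A : AgentAlgorithm State Msg) (H : PortGraph (Fin n))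
    (c : Config State n k) (i : Fin k) : State × Option ℕ :=
  A.compute (c.state i) (c.view H (c.pos i)) (A.inbox H c i)

/-- The node reached from `v` through port `p`; nothing happens if there is no such port. -/
def moveThrough (H : PortGraph (Fin n)) (v : Fin n) : Option ℕ → Fin n
  | none => v
  | some p => if h : p < H.deg v then (H.port v ⟨p, h⟩ : Fin n) else v

open Classical in
/-- One synchronous Communicate-Compute-Move round. Terminated agents stay as they are. -/
noncomputable def round (A : AgentAlgorithm State Msg) (H : PortGraph (Fin n))
    (c : Config State n k) : Config State n k where
  pos := fun i =>
    if A.terminated (c.state i) then c.pos i else moveThrough H (c.pos i) (A.decision H c i).2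
  state := fun i => if A.terminated (c.state i) then c.state i else (A.decision H c i).1

/-- The execution of `A` on `G` from the initial placement `place`, the parameter `T` being known
to the agents: `A.run T G place r` is the configuration at the start of round `r`, that is, after
`r` rounds. -/
noncomputable def run (A : AgentAlgorithm State Msg) (T : ℕ) (G : DynamicGraph (Fin n))
    (place : Fin k → Fin n) : ℕ → Config State n k
  | 0 => ⟨place, fun i => A.init (agentID i) T⟩
  | r + 1 => A.round (G r) (A.run T G place r)

/-- Explicit dispersion: no agent terminates before the configuration is dispersed, and at some
time all agents have terminated in a dispersed configuration. -/
def SolvesExplicitDispersion (A : AgentAlgorithm State Msg) (T : ℕ) (G : DynamicGraph (Fin n))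
    (place : Fin k → Fin n) : Prop :=
  (∀ r, (∃ i, A.terminated ((A.run T G place r).state i)) → (A.run T G place r).Dispersed) ∧
    ∃ r, (A.run T G place r).AllTerminated A ∧ (A.run T G place r).Dispersed

end AgentAlgorithm

/-! ## Sliding paths -/

/-- A broadcast: the sender's ID, the number of agents at its node, and its 1-hop information. -/
structure Message where
  id : ℕ
  count : ℕ
  view : View

/-- The smallest ID in a set. -/
def minID (S : Finset ℕ) : Option ℕ := if h : S.Nonempty then some (S.min' h) else none

/-- The smallest ID among the senders located at multinodes. -/
def leader (M : List Message) : Option ℕ :=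
  ((M.filter fun m => decide (1 < m.count)).map Message.id).min?

/-- The 1-hop information reported by the agent `a`, a list indexed by the ports of its node. -/
def reported (M : List Message) (a : ℕ) : List (Finset ℕ) :=
  ((M.find? fun m => decide (m.id = a)).map fun m => m.view.nbr).getD []

/-- `[(b₁, q₁), …, (bₗ, qₗ)]` describes a path of occupied nodes into a hole: the node of `bⱼ` is
joined by its port `qⱼ` to a node whose minimum-ID agent is `bⱼ₊₁`, and the port `qₗ` of the
node of `bₗ` leads to a hole. -/
def LeadsToHole (M : List Message) : List (ℕ × ℕ) → Prop
  | [] => False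
  | [(a, q)] => (reported M a)[q]? = some ∅
  | (a, q) :: (b, q') :: P =>
    (∃ S, (reported M a)[q]? = some S ∧ minID S = some b) ∧ LeadsToHole M ((b, q') :: P)

/-- A sliding path: a path without repetitions through occupied nodes into a hole, which starts
with the minimum-ID agent among those broadcasting from multinodes. -/
def IsSlidingPath (M : List Message) (P : List (ℕ × ℕ)) : Prop :=
  P.head?.map Prod.fst = leader M ∧ LeadsToHole M P ∧ (P.map Prod.fst).Nodup

/-- A rule by which all agents select, from the messages of the component alone, a sliding path
whenever there is one. -/
def IsSlidingRule (σ : List Message → List (ℕ × ℕ)) : Prop :=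
  ∀ M, (∃ P, IsSlidingPath M P) → IsSlidingPath M (σ M)

/-- All routes with `l + 1` moves from the node of `a` through occupied nodes into a hole. -/
def routes (M : List Message) : ℕ → ℕ → List (List (ℕ × ℕ))
  | 0, a => ((List.range (reported M a).length).filter fun q =>
      decide ((reported M a)[q]? = some ∅)).map fun q => [(a, q)]
  | l + 1, a => (List.range (reported M a).length).flatMap fun q =>
      match (reported M a)[q]?.bind minID with
      | some b => (routes M l b).map fun P => (a, q) :: P
      | none => []

/-- The sliding subroutine by breadth-first search: a shortest path from the leader's node to a
hole, ties being broken by the port numbers. -/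
def shortestSlide (M : List Message) : List (ℕ × ℕ) :=
  match leader M with
  | none => []
  | some a => ((List.range M.length).findSome? fun l => (routes M l a).head?).getD []

/-! ## The algorithm -/

/-- The memory of an agent between rounds. -/
structure AgentState where
  id : ℕ
  T : ℕ
  t : ℕ
  done : Bool

/-- The number of memory bits: the binary lengths of the three numbers and one flag. -/
def AgentState.bits (s : AgentState) : ℕ := s.id.size + s.T.size + s.t.size + 1

/-- Some neighbour is a hole. -/
def View.SeesHole (v : View) : Prop := ∅ ∈ v.nbr

open Classical in
/-- The algorithm, with the sliding rule `σ` as a subroutine. The minimum-ID agent at each node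
broadcasts. An agent that is at a multinode or hears of one resets `t` and, if it sees or
hears of a hole, makes the move (if any) assigned to it by the sliding path. An agent that knows of
no multinode stays and increments `t`, and it terminates when `t` reaches `T`. -/
noncomputable def explicitDispersion (σ : List Message → List (ℕ × ℕ)) :
    AgentAlgorithm AgentState Message where
  init := fun ID T => ⟨ID, T, 0, false⟩
  broadcast := fun s v => if minID v.here = some s.id then some ⟨s.id, v.here.card, v⟩ else none
  compute := fun s v M =>
    if 1 < v.here.card ∨ ∃ m ∈ M, 1 < m.count then
      ({ s with t := 0 },
        if v.SeesHole ∨ ∃ m ∈ M, m.view.SeesHole then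
          ((σ M).find? fun x => decide (x.1 = s.id)).map Prod.snd
        else none)
    else ({ s with t := s.t + 1, done := decide (s.t + 1 = s.T) }, none)
  terminated := fun s => s.done = true

/-! ## Sliding paths in a list of messages -/

/-! Before anyone terminates, all agents of a component receive the same messages, so they agree on
one sliding path. Executing it shifts one agent along each edge: the first node is a multinode and
keeps an agent, every inner node loses its minimum agent and gains its predecessor's, and one hole
is filled (`exists_isSlide`). Hence occupied nodes stay occupied and no multinode is created
(`exists_pos_round_eq`, `isMultinode_of_round`).

Upper bound: if the configuration is not dispersed at the end of a window of `T` rounds, some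
multinode and some hole have persisted through the whole window. `T`-Path Connectivity joins them in
one of its rounds, and that round fills a hole (`card_occupied_lt`). So `(k - 1) * T` rounds
disperse the agents, and `T` further rounds bring every counter to `T`.

Safety: while its counter grows, an agent stays put and is cut off from all multinodes. A multinode
present now was one in all those rounds, so a counter equal to `T` would contradict connectivity.
Since the slide analysis itself requires that nobody has terminated, both facts are proved in one
induction (`not_reachable_of_counter`).

Lower bound: with all agents on one node and a graph that is edgeless except for one complete round
in every `T`, at most one node becomes occupied per `T` rounds (`card_occupied_slowGraph_le`). -/

theorem minID_eq_some_iff {S : Finset ℕ} {b : ℕ} :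
    minID S = some b ↔ b ∈ S ∧ ∀ x ∈ S, b ≤ x := by
  unfold minID
  split_ifs with h
  · simp only [Option.some.injEq]
    constructor
    · rintro rfl
      exact ⟨S.min'_mem h, fun x hx => S.min'_le x hx⟩
    · rintro ⟨hb, hle⟩
      exact le_antisymm (S.min'_le b hb) (hle _ (S.min'_mem h))
  · simp only [false_iff, not_and]
    exact fun hb => absurd ⟨b, hb⟩ h

theorem minID_eq_none_iff {S : Finset ℕ} : minID S = none ↔ S = ∅ := by
  unfold minID
  split_ifs with h
  · simpa using h.ne_empty
  · simpa using Finset.not_nonempty_iff_eq_empty.1 h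

theorem LeadsToHole.ne_nil {M : List Message} {P : List (ℕ × ℕ)} (h : LeadsToHole M P) :
    P ≠ [] := by
  rintro rfl
  exact h

/-- The first step of a route ends at the minimum-ID agent of the rest, or, if there is no rest, in
a hole. -/
theorem leadsToHole_cons_iff {M : List Message} {a q : ℕ} {P : List (ℕ × ℕ)} :
    LeadsToHole M ((a, q) :: P) ↔
      (∃ S, (reported M a)[q]? = some S ∧ minID S = P.head?.map Prod.fst) ∧
        (P ≠ [] → LeadsToHole M P) := by
  rcases P with _ | ⟨⟨b, q'⟩, P⟩
  · simp [LeadsToHole, minID_eq_none_iff]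
  · simp [LeadsToHole]

theorem LeadsToHole.of_append {M : List Message} {A B : List (ℕ × ℕ)}
    (h : LeadsToHole M (A ++ B)) (hB : B ≠ []) : LeadsToHole M B := by
  induction A with
  | nil => exact h
  | cons x A ih => exact ih ((leadsToHole_cons_iff.1 h).2 (by simp [hB]))

/-- Inner steps and the final step take one form: `none` on the right marks the end of the route,
and `minID` is `none` exactly on a hole. -/
theorem LeadsToHole.getElem {M : List Message} {P : List (ℕ × ℕ)} (h : LeadsToHole M P)
    (m : ℕ) (hm : m < P.length) :
    ∃ S, (reported M P[m].1)[P[m].2]? = some S ∧ minID S = P[m + 1]?.map Prod.fst := by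
  induction P generalizing m with
  | nil => simp at hm
  | cons x P ih =>
    obtain ⟨h1, h2⟩ := leadsToHole_cons_iff.1 h
    rcases m with _ | m
    · simpa [List.head?_eq_getElem?] using h1
    · have hm' : m < P.length := by simpa using hm
      simpa using ih (h2 (List.ne_nil_of_length_pos (by omega))) m hm'

/-- A route that visits an agent twice can be shortened. -/
theorem LeadsToHole.exists_shorter {M : List Message} {P : List (ℕ × ℕ)} (h : LeadsToHole M P)
    (hP : ¬ (P.map Prod.fst).Nodup) :
    ∃ P', LeadsToHole M P' ∧ P'.head?.map Prod.fst = P.head?.map Prod.fst ∧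
      P'.length < P.length := by
  induction P with
  | nil => simp at hP
  | cons x Q ih =>
    by_cases hx : x.1 ∈ Q.map Prod.fst
    · obtain ⟨y, hy, hyx⟩ := List.mem_map.1 hx
      obtain ⟨A, B, rfl⟩ := List.append_of_mem hy
      refine ⟨y :: B, LeadsToHole.of_append (A := x :: A) h (by simp), by simp [hyx], ?_⟩
      simp
    · have hQ : ¬ (Q.map Prod.fst).Nodup := fun hn => hP (by simpa using ⟨by simpa using hx, hn⟩)
      have hne : Q ≠ [] := by rintro rfl; simp at hQ
      obtain ⟨h1, h2⟩ := leadsToHole_cons_iff.1 h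
      obtain ⟨Q', hQ', hhead, hlen⟩ := ih (h2 hne) hQ
      refine ⟨x :: Q', leadsToHole_cons_iff.2 ⟨?_, fun _ => hQ'⟩, by simp, by simpa using hlen⟩
      rw [hhead]
      exact h1

theorem LeadsToHole.exists_nodup {M : List Message} {P : List (ℕ × ℕ)} (h : LeadsToHole M P) :
    ∃ P', LeadsToHole M P' ∧ P'.head?.map Prod.fst = P.head?.map Prod.fst ∧
      (P'.map Prod.fst).Nodup := by
  induction hl : P.length using Nat.strong_induction_on generalizing P with
  | _ l ih =>
    by_cases hP : (P.map Prod.fst).Nodup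
    · exact ⟨P, h, rfl, hP⟩
    · obtain ⟨Q, hQ, hhead, hlen⟩ := h.exists_shorter hP
      obtain ⟨P', h1, h2, h3⟩ := ih _ (hl ▸ hlen) hQ rfl
      exact ⟨P', h1, h2.trans hhead, h3⟩

theorem mem_map_id_of_reported_ne_nil {M : List Message} {a : ℕ} (h : reported M a ≠ []) :
    a ∈ M.map Message.id := by
  unfold reported at h
  cases hf : M.find? (fun m => decide (m.id = a)) with
  | none => simp [hf] at h
  | some m =>
    have h1 := List.find?_some hf
    exact List.mem_map.2 ⟨m, List.mem_of_find?_eq_some hf, by simpa using h1⟩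

/-- Every agent on a route has a nonempty report, hence sent a message. This justifies the cut-off
`M.length` in the breadth-first search. -/
theorem LeadsToHole.length_le {M : List Message} {P : List (ℕ × ℕ)} (h : LeadsToHole M P)
    (hP : (P.map Prod.fst).Nodup) : P.length ≤ M.length := by
  have hsub : P.map Prod.fst ⊆ M.map Message.id := by
    intro a ha
    obtain ⟨m, hm, rfl⟩ := List.getElem_of_mem ha
    obtain ⟨S, hS, -⟩ := h.getElem m (by simpa using hm)
    rw [List.getElem_map]
    refine mem_map_id_of_reported_ne_nil fun hnil => ?_
    simp [hnil] at hS
  simpa using (hP.subperm hsub).length_le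

theorem mem_routes_iff {M : List Message} {l a : ℕ} {P : List (ℕ × ℕ)} :
    P ∈ routes M l a ↔
      LeadsToHole M P ∧ P.head?.map Prod.fst = some a ∧ P.length = l + 1 := by
  induction l generalizing a P with
  | zero =>
    simp only [routes, List.mem_map, List.mem_filter, List.mem_range, decide_eq_true_eq]
    constructor
    · rintro ⟨q, ⟨-, hq⟩, rfl⟩
      exact ⟨hq, rfl, rfl⟩
    · rintro ⟨h, hhead, hlen⟩
      obtain ⟨⟨b, q⟩, rfl⟩ := List.length_eq_one_iff.1 hlen
      obtain rfl : b = a := by simpa using hhead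
      have hq : (reported M b)[q]? = some ∅ := h
      exact ⟨q, ⟨(List.getElem?_eq_some_iff.1 hq).1, hq⟩, rfl⟩
  | succ l ih =>
    simp only [routes, List.mem_flatMap, List.mem_range]
    constructor
    · rintro ⟨q, -, hP⟩
      split at hP
      · rename_i b hb
        obtain ⟨Q, hQ, rfl⟩ := List.mem_map.1 hP
        obtain ⟨h1, h2, h3⟩ := ih.1 hQ
        refine ⟨leadsToHole_cons_iff.2 ⟨?_, fun _ => h1⟩, rfl, by simp [h3]⟩
        rw [h2]
        exact Option.bind_eq_some_iff.1 hb
      · simp at hP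
    · rintro ⟨h, hhead, hlen⟩
      rcases P with _ | ⟨⟨b, q⟩, Q⟩
      · simp at hlen
      obtain rfl : b = a := by simpa using hhead
      have hne : Q ≠ [] := by rintro rfl; simp at hlen
      obtain ⟨⟨S, hS, hmin⟩, h2⟩ := leadsToHole_cons_iff.1 h
      refine ⟨q, (List.getElem?_eq_some_iff.1 hS).1, ?_⟩
      obtain ⟨⟨b', q'⟩, Q', rfl⟩ := List.exists_cons_of_ne_nil hne
      have hb : (reported M b)[q]?.bind minID = some b' := by simp [hS, hmin]
      rw [hb]
      exact List.mem_map.2 ⟨_, ih.2 ⟨h2 hne, rfl, by simpa using hlen⟩, rfl⟩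

/-- `routes` does not forbid repetitions; they are excluded by minimality, since a route with a
repeated agent could be shortened and would have been preceded by a nonempty level. -/
theorem isSlidingRule_shortestSlide : IsSlidingRule shortestSlide := by
  rintro M ⟨P, hlead, hP, hnodup⟩
  obtain ⟨⟨a, q⟩, Q, rfl⟩ := List.exists_cons_of_ne_nil hP.ne_nil
  have hl : leader M = some a := by simpa using hlead.symm
  have hlen := hP.length_le hnodup
  have hmem : (a, q) :: Q ∈ routes M Q.length a := mem_routes_iff.2 ⟨hP, rfl, rfl⟩
  unfold shortestSlide
  simp only [hl]
  cases hf : (List.range M.length).findSome? fun l => (routes M l a).head? with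
  | none =>
    have := List.findSome?_eq_none_iff.1 hf Q.length (by simpa using hlen)
    rw [List.head?_eq_none_iff] at this
    simp [this] at hmem
  | some R =>
    obtain ⟨l₁, l, l₂, hsplit, hR, hbefore⟩ := List.findSome?_eq_some_iff.1 hf
    obtain ⟨h1, h2, h3⟩ := mem_routes_iff.1 (List.mem_of_head? hR)
    refine ⟨by simpa [hl] using h2, h1, ?_⟩
    by_contra hn
    obtain ⟨R', h1', h2', h3'⟩ := h1.exists_shorter hn
    have hpos := List.length_pos_iff.2 h1'.ne_nil
    have hmem' : R' ∈ routes M (R'.length - 1) a :=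
      mem_routes_iff.2 ⟨h1', h2'.trans h2, by omega⟩
    have hlt : R'.length - 1 < l := by omega
    -- `List.range` is increasing, so a level below `l` was searched before `l`.
    have hin : R'.length - 1 ∈ l₁ := by
      have hpw : (l₁ ++ l :: l₂).Pairwise (· < ·) := hsplit ▸ List.pairwise_lt_range
      have hlm : l < M.length := List.mem_range.1 (hsplit ▸ by simp)
      have : R'.length - 1 ∈ l₁ ++ l :: l₂ := hsplit ▸ List.mem_range.2 (by omega)
      rcases List.mem_append.1 this with h | h
      · exact h
      · rcases List.mem_cons.1 h with h | h
        · omega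
        · have := List.rel_of_pairwise_cons (List.pairwise_append.1 hpw).2.1 h
          omega
    have := hbefore _ hin
    rw [List.head?_eq_none_iff] at this
    simp [this] at hmem'

/-! ## Agents at a node -/

theorem agentID_injective {k : ℕ} : Function.Injective (agentID (k := k)) := fun i j h =>
  Fin.ext (by simpa [agentID] using h)

namespace Config

variable {State : Type} {n k : ℕ} {c : Config State n k} {v : Fin n}

theorem mem_idsAt_iff {x : ℕ} : x ∈ c.idsAt v ↔ ∃ i, c.pos i = v ∧ agentID i = x := by
  simp [idsAt]

theorem agentID_mem_idsAt_iff {i : Fin k} : agentID i ∈ c.idsAt v ↔ c.pos i = v := by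
  rw [mem_idsAt_iff]
  exact ⟨fun ⟨j, hj, h⟩ => agentID_injective h ▸ hj, fun h => ⟨i, h, rfl⟩⟩

theorem idsAt_eq_empty_iff : c.idsAt v = ∅ ↔ ∀ i, c.pos i ≠ v := by
  simp [Finset.eq_empty_iff_forall_notMem, mem_idsAt_iff]

/-- The node `v` is a multinode. -/
def IsMultinode (c : Config State n k) (v : Fin n) : Prop := 1 < (c.idsAt v).card

theorem isMultinode_iff : c.IsMultinode v ↔ ∃ i j, i ≠ j ∧ c.pos i = v ∧ c.pos j = v := by
  rw [IsMultinode, Finset.one_lt_card]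
  constructor
  · rintro ⟨a, ha, b, hb, hab⟩
    obtain ⟨i, hi, rfl⟩ := mem_idsAt_iff.1 ha
    obtain ⟨j, hj, rfl⟩ := mem_idsAt_iff.1 hb
    exact ⟨i, j, fun h => hab (h ▸ rfl), hi, hj⟩
  · rintro ⟨i, j, hij, hi, hj⟩
    exact ⟨_, agentID_mem_idsAt_iff.2 hi, _, agentID_mem_idsAt_iff.2 hj,
      fun h => hij (agentID_injective h)⟩

theorem not_dispersed_iff : ¬ c.Dispersed ↔ ∃ v, c.IsMultinode v := by
  simp only [Dispersed, Function.Injective, isMultinode_iff]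
  push Not
  exact ⟨fun ⟨i, j, h, hne⟩ => ⟨_, i, j, hne, h, rfl⟩,
    fun ⟨v, i, j, hne, hi, hj⟩ => ⟨i, j, hi.trans hj.symm, hne⟩⟩

/-- The agent `i` has the smallest ID at its node. -/
def IsMin (c : Config State n k) (i : Fin k) : Prop :=
  minID (c.idsAt (c.pos i)) = some (agentID i)

theorem minID_idsAt_eq_some_iff {i : Fin k} :
    minID (c.idsAt v) = some (agentID i) ↔ c.pos i = v ∧ c.IsMin i := by
  constructor
  · intro h
    obtain rfl := agentID_mem_idsAt_iff.1 (minID_eq_some_iff.1 h).1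
    exact ⟨rfl, h⟩
  · rintro ⟨rfl, h⟩
    exact h

theorem exists_isMin (c : Config State n k) (i : Fin k) : ∃ j, c.pos j = c.pos i ∧ c.IsMin j := by
  cases h : minID (c.idsAt (c.pos i)) with
  | none => exact absurd rfl (idsAt_eq_empty_iff.1 (minID_eq_none_iff.1 h) i)
  | some b =>
    obtain ⟨j, -, rfl⟩ := mem_idsAt_iff.1 (minID_eq_some_iff.1 h).1
    exact ⟨j, minID_idsAt_eq_some_iff.1 h⟩

theorem IsMin.eq {i j : Fin k} (hi : c.IsMin i) (hj : c.IsMin j) (h : c.pos i = c.pos j) :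
    i = j := by
  unfold IsMin at hi hj
  rw [h, hj] at hi
  exact agentID_injective (Option.some.inj hi).symm

theorem view_nbr_getElem? {H : PortGraph (Fin n)} {q : ℕ} {S : Finset ℕ} :
    (c.view H v).nbr[q]? = some S ↔
      q < H.deg v ∧ c.idsAt (AgentAlgorithm.moveThrough H v (some q)) = S := by
  simp only [view, List.getElem?_eq_some_iff, List.length_ofFn, List.getElem_ofFn,
    AgentAlgorithm.moveThrough]
  constructor
  · rintro ⟨h, hS⟩
    exact ⟨h, by simpa [h] using hS⟩
  · rintro ⟨h, hS⟩
    exact ⟨h, by simpa [h] using hS⟩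

end Config

namespace AgentAlgorithm

variable {n : ℕ} {H : PortGraph (Fin n)} {v : Fin n}

theorem adj_moveThrough {q : ℕ} (hq : q < H.deg v) :
    H.graph.Adj v (moveThrough H v (some q)) := by
  rw [moveThrough, dif_pos hq]
  exact (H.port v ⟨q, hq⟩).2

theorem exists_moveThrough_eq {w : Fin n} (h : H.graph.Adj v w) :
    ∃ q, q < H.deg v ∧ moveThrough H v (some q) = w := by
  refine ⟨(H.port v).symm ⟨w, h⟩, ((H.port v).symm ⟨w, h⟩).2, ?_⟩
  simp [moveThrough]

theorem reachable_moveThrough (H : PortGraph (Fin n)) (v : Fin n) (p : Option ℕ) :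
    H.graph.Reachable v (moveThrough H v p) := by
  rcases p with _ | q
  · exact SimpleGraph.Reachable.refl _
  · by_cases hq : q < H.deg v
    · exact (adj_moveThrough hq).reachable
    · simp [moveThrough, hq]

end AgentAlgorithm

/-! ## One round of the algorithm -/

namespace Config

variable {n k : ℕ} {σ : List Message → List (ℕ × ℕ)} {H : PortGraph (Fin n)}
  {c : Config AgentState n k} {i : Fin k}

open AgentAlgorithm

/-- The agents carry their own IDs in their memory. -/
def StoresIDs (c : Config AgentState n k) : Prop := ∀ i, (c.state i).id = agentID i

/-- No agent has terminated. -/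
def Active (c : Config AgentState n k) : Prop := ∀ i, (c.state i).done = false

theorem mem_inbox_iff (hid : c.StoresIDs) {m : Message} :
    m ∈ (explicitDispersion σ).inbox H c i ↔
      ∃ j, (c.state j).done = false ∧ H.graph.Reachable (c.pos i) (c.pos j) ∧ c.IsMin j ∧
        m = ⟨agentID j, (c.idsAt (c.pos j)).card, c.view H (c.pos j)⟩ := by
  simp only [inbox, List.mem_filterMap, List.mem_finRange, true_and]
  refine exists_congr fun j => ?_
  have hj : (c.view H (c.pos j)).here = c.idsAt (c.pos j) := rfl
  simp only [explicitDispersion, hid j, hj, IsMin]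
  by_cases h1 : (c.state j).done = false <;> by_cases h2 : H.graph.Reachable (c.pos i) (c.pos j) <;>
    by_cases h3 : minID (c.idsAt (c.pos j)) = some (agentID j) <;> simp [h1, h2, h3, eq_comm]

/-- This makes the agents of a component evaluate `σ` on the same list, so they follow the same
path. -/
theorem inbox_eq_of_reachable {j : Fin k} (h : H.graph.Reachable (c.pos i) (c.pos j)) :
    (explicitDispersion σ).inbox H c j = (explicitDispersion σ).inbox H c i := by
  have hiff : ∀ l, H.graph.Reachable (c.pos j) (c.pos l) ↔ H.graph.Reachable (c.pos i) (c.pos l) :=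
    fun l => ⟨h.trans, h.symm.trans⟩
  unfold inbox
  congr 1
  funext l
  classical exact if_congr (and_congr_right fun _ => hiff l) rfl rfl

theorem reported_inbox (hid : c.StoresIDs) (hact : c.Active) {j : Fin k}
    (hr : H.graph.Reachable (c.pos i) (c.pos j)) (hj : c.IsMin j) :
    reported ((explicitDispersion σ).inbox H c i) (agentID j) = (c.view H (c.pos j)).nbr := by
  unfold reported
  cases hf : ((explicitDispersion σ).inbox H c i).find? fun m => decide (m.id = agentID j) with
  | none =>
    have := List.find?_eq_none.1 hf _ ((mem_inbox_iff hid).2 ⟨j, hact j, hr, hj, rfl⟩)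
    simp at this
  | some m =>
    obtain ⟨j', -, -, -, rfl⟩ := (mem_inbox_iff hid).1 (List.mem_of_find?_eq_some hf)
    have : agentID j' = agentID j := by simpa using List.find?_some hf
    obtain rfl := agentID_injective this
    rfl

theorem reported_inbox_getElem? (hid : c.StoresIDs) (hact : c.Active) {a q : ℕ} {S : Finset ℕ} :
    (reported ((explicitDispersion σ).inbox H c i) a)[q]? = some S ↔
      ∃ j, agentID j = a ∧ H.graph.Reachable (c.pos i) (c.pos j) ∧ c.IsMin j ∧
        q < H.deg (c.pos j) ∧ c.idsAt (moveThrough H (c.pos j) (some q)) = S := by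
  constructor
  · intro h
    have hne : reported ((explicitDispersion σ).inbox H c i) a ≠ [] := by
      intro hnil
      simp [hnil] at h
    obtain ⟨m, hm, rfl⟩ := List.mem_map.1 (mem_map_id_of_reported_ne_nil hne)
    obtain ⟨j, -, hr, hj, rfl⟩ := (mem_inbox_iff hid).1 hm
    rw [reported_inbox hid hact hr hj, view_nbr_getElem?] at h
    exact ⟨j, rfl, hr, hj, h⟩
  · rintro ⟨j, rfl, hr, hj, h⟩
    rw [reported_inbox hid hact hr hj, view_nbr_getElem?]
    exact h

theorem leader_inbox_eq_some (hid : c.StoresIDs) {a : ℕ}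
    (h : leader ((explicitDispersion σ).inbox H c i) = some a) :
    ∃ j, agentID j = a ∧ H.graph.Reachable (c.pos i) (c.pos j) ∧ c.IsMin j ∧
      c.IsMultinode (c.pos j) := by
  obtain ⟨m, hm, rfl⟩ := List.mem_map.1 (List.min?_mem h)
  obtain ⟨hm, hcard⟩ := List.mem_filter.1 hm
  obtain ⟨j, -, hr, hj, rfl⟩ := (mem_inbox_iff hid).1 hm
  exact ⟨j, rfl, hr, hj, by simpa [IsMultinode] using hcard⟩

theorem leader_inbox_ne_none (hid : c.StoresIDs) (hact : c.Active) {j : Fin k}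
    (hr : H.graph.Reachable (c.pos i) (c.pos j)) (hj : c.IsMultinode (c.pos j)) :
    leader ((explicitDispersion σ).inbox H c i) ≠ none := by
  intro h
  rw [leader, List.min?_eq_none_iff, List.map_eq_nil_iff, List.filter_eq_nil_iff] at h
  obtain ⟨j', hpos, hmin⟩ := c.exists_isMin j
  have := h _ ((mem_inbox_iff hid).2 ⟨j', hact j', hpos ▸ hr, hmin, rfl⟩)
  rw [hpos] at this
  exact this (decide_eq_true hj)

/-- Follow the walk up to its first hole, naming each node by its minimum agent. The walk may
revisit nodes; repetitions are removed afterwards. -/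
theorem exists_leadsToHole (hid : c.StoresIDs) (hact : c.Active) {j : Fin k} {w : Fin n}
    (hr : H.graph.Reachable (c.pos i) (c.pos j)) (hj : c.IsMin j)
    (hw : ∀ l, c.pos l ≠ w) (p : H.graph.Walk (c.pos j) w) :
    ∃ P, LeadsToHole ((explicitDispersion σ).inbox H c i) P ∧
      P.head?.map Prod.fst = some (agentID j) := by
  generalize hu : c.pos j = u at p
  induction p generalizing j with
  | nil => exact absurd hu (hw j)
  | @cons u v w hadj p ih =>
    subst hu
    obtain ⟨q, hq, rfl⟩ := exists_moveThrough_eq hadj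
    have hS := (reported_inbox_getElem? (σ := σ) hid hact).2 ⟨j, rfl, hr, hj, hq, rfl⟩
    by_cases hhole : ∀ l, c.pos l ≠ moveThrough H (c.pos j) (some q)
    · exact ⟨[(agentID j, q)], by rwa [idsAt_eq_empty_iff.2 hhole] at hS, rfl⟩
    · push Not at hhole
      obtain ⟨l, hl⟩ := hhole
      obtain ⟨j', hpos, hmin⟩ := c.exists_isMin l
      obtain ⟨P, hP, hhead⟩ := ih (hpos.trans hl ▸ hr.trans hadj.reachable) hmin hw
        (hpos.trans hl)
      refine ⟨(agentID j, q) :: P, leadsToHole_cons_iff.2 ⟨⟨_, hS, ?_⟩, fun _ => hP⟩, rfl⟩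
      rw [hhead]
      exact minID_idsAt_eq_some_iff.2 ⟨hpos.trans hl, hmin⟩

/-- The leader may sit at another multinode than the given one, but it lies in the same component
and so also reaches the hole. -/
theorem exists_isSlidingPath (hid : c.StoresIDs) (hact : c.Active) {j : Fin k} {w : Fin n}
    (hr : H.graph.Reachable (c.pos i) (c.pos j)) (hj : c.IsMultinode (c.pos j))
    (hrw : H.graph.Reachable (c.pos i) w) (hw : ∀ l, c.pos l ≠ w) :
    ∃ P, IsSlidingPath ((explicitDispersion σ).inbox H c i) P := by
  obtain ⟨a, ha⟩ := Option.ne_none_iff_exists'.1 (leader_inbox_ne_none (σ := σ) hid hact hr hj)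
  obtain ⟨l, rfl, hrl, hmin, -⟩ := leader_inbox_eq_some hid ha
  obtain ⟨p⟩ := hrl.symm.trans hrw
  obtain ⟨P, hP, hhead⟩ := exists_leadsToHole (σ := σ) hid hact hrl hmin hw p
  obtain ⟨P', hP', hhead', hnodup⟩ := hP.exists_nodup
  exact ⟨P', by rw [hhead', hhead, ha], hP', hnodup⟩

/-- The component of `v` contains a multinode. -/
def MultinodeNear (c : Config AgentState n k) (H : PortGraph (Fin n)) (v : Fin n) : Prop :=
  ∃ u, H.graph.Reachable v u ∧ c.IsMultinode u

/-- The component of `v` contains a hole. -/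
def HoleNear (c : Config AgentState n k) (H : PortGraph (Fin n)) (v : Fin n) : Prop :=
  ∃ w, H.graph.Reachable v w ∧ ∀ l, c.pos l ≠ w

theorem IsMultinode.exists_pos_eq {v : Fin n} (h : c.IsMultinode v) : ∃ j, c.pos j = v := by
  obtain ⟨j, -, -, hj, -⟩ := isMultinode_iff.1 h
  exact ⟨j, hj⟩

theorem knows_multinode_iff (hid : c.StoresIDs) (hact : c.Active) :
    (1 < (c.view H (c.pos i)).here.card ∨
      ∃ m ∈ (explicitDispersion σ).inbox H c i, 1 < m.count) ↔ c.MultinodeNear H (c.pos i) := by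
  constructor
  · rintro (h | ⟨m, hm, hcard⟩)
    · exact ⟨_, SimpleGraph.Reachable.refl _, h⟩
    · obtain ⟨j, -, hr, -, rfl⟩ := (mem_inbox_iff hid).1 hm
      exact ⟨_, hr, hcard⟩
  · rintro ⟨u, hr, hu⟩
    obtain ⟨j, rfl⟩ := hu.exists_pos_eq
    obtain ⟨j', hpos, hmin⟩ := c.exists_isMin j
    exact Or.inr ⟨_, (mem_inbox_iff hid).2 ⟨j', hact j', hpos ▸ hr, hmin, rfl⟩, hpos ▸ hu⟩

theorem seesHole_iff {v : Fin n} :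
    (c.view H v).SeesHole ↔ ∃ w, H.graph.Adj v w ∧ ∀ l, c.pos l ≠ w := by
  unfold View.SeesHole
  rw [List.mem_iff_getElem?]
  constructor
  · rintro ⟨q, hq⟩
    obtain ⟨hlt, hS⟩ := view_nbr_getElem?.1 hq
    exact ⟨_, adj_moveThrough hlt, idsAt_eq_empty_iff.1 hS⟩
  · rintro ⟨w, hadj, hw⟩
    obtain ⟨q, hq, rfl⟩ := exists_moveThrough_eq hadj
    exact ⟨q, view_nbr_getElem?.2 ⟨hq, idsAt_eq_empty_iff.2 hw⟩⟩

theorem knows_hole_iff (hid : c.StoresIDs) (hact : c.Active) :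
    ((c.view H (c.pos i)).SeesHole ∨
      ∃ m ∈ (explicitDispersion σ).inbox H c i, m.view.SeesHole) ↔ c.HoleNear H (c.pos i) := by
  constructor
  · rintro (h | ⟨m, hm, h⟩)
    · obtain ⟨w, hadj, hw⟩ := seesHole_iff.1 h
      exact ⟨w, hadj.reachable, hw⟩
    · obtain ⟨j, -, hr, -, rfl⟩ := (mem_inbox_iff hid).1 hm
      obtain ⟨w, hadj, hw⟩ := seesHole_iff.1 h
      exact ⟨w, hr.trans hadj.reachable, hw⟩
  · rintro ⟨w, ⟨p⟩, hw⟩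
    -- The agent just before the first hole on the walk sees that hole; the minimum agent at its
    -- node reports it.
    suffices ∀ {u w : Fin n} (p : H.graph.Walk u w), (∀ l, c.pos l ≠ w) → ∀ j, c.pos j = u →
        ∃ l, H.graph.Reachable u (c.pos l) ∧ (c.view H (c.pos l)).SeesHole by
      obtain ⟨l, hr, hl⟩ := this p hw i rfl
      obtain ⟨l', hpos, hmin⟩ := c.exists_isMin l
      exact Or.inr ⟨_, (mem_inbox_iff hid).2 ⟨l', hact l', hpos ▸ hr, hmin, rfl⟩, hpos ▸ hl⟩
    intro u w p
    induction p with
    | nil => exact fun h j hj => absurd hj (h j)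
    | @cons u v w hadj p ih =>
      intro hw j hj
      by_cases hhole : ∀ l, c.pos l ≠ v
      · subst hj
        exact ⟨j, SimpleGraph.Reachable.refl _, seesHole_iff.2 ⟨v, hadj, hhole⟩⟩
      · push Not at hhole
        obtain ⟨l, hl⟩ := hhole
        obtain ⟨l', hr, hl'⟩ := ih hw l hl
        exact ⟨l', hadj.reachable.trans hr, hl'⟩

theorem pos_round (hact : c.Active) :
    ((explicitDispersion σ).round H c).pos i =
      moveThrough H (c.pos i) ((explicitDispersion σ).decision H c i).2 := by
  simp [AgentAlgorithm.round, explicitDispersion, hact i]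

theorem pos_round_of_not (hid : c.StoresIDs) (hact : c.Active)
    (h : ¬ (c.MultinodeNear H (c.pos i) ∧ c.HoleNear H (c.pos i))) :
    ((explicitDispersion σ).round H c).pos i = c.pos i := by
  rw [pos_round hact]
  rw [← knows_multinode_iff (σ := σ) hid hact, ← knows_hole_iff (σ := σ) hid hact] at h
  rw [not_and] at h
  simp only [decision]
  by_cases h1 : 1 < (c.view H (c.pos i)).here.card ∨
      ∃ m ∈ (explicitDispersion σ).inbox H c i, 1 < m.count
  · have h2 := h h1
    simp only [explicitDispersion] at h1 h2 ⊢
    simp only [if_pos h1, if_neg h2, moveThrough]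
  · simp only [explicitDispersion] at h1 ⊢
    simp only [if_neg h1, moveThrough]

theorem pos_round_of_near (hid : c.StoresIDs) (hact : c.Active)
    (h1 : c.MultinodeNear H (c.pos i)) (h2 : c.HoleNear H (c.pos i)) :
    ((explicitDispersion σ).round H c).pos i = moveThrough H (c.pos i)
      (((σ ((explicitDispersion σ).inbox H c i)).find? fun x =>
        decide (x.1 = agentID i)).map Prod.snd) := by
  rw [pos_round hact]
  rw [← knows_multinode_iff (σ := σ) hid hact] at h1
  rw [← knows_hole_iff (σ := σ) hid hact] at h2
  simp only [decision]
  simp only [explicitDispersion] at h1 h2 ⊢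
  simp only [if_pos h1, if_pos h2, hid i]

theorem reachable_pos_round (hact : c.Active) :
    H.graph.Reachable (c.pos i) (((explicitDispersion σ).round H c).pos i) := by
  rw [pos_round hact]
  exact reachable_moveThrough _ _ _

/-- In the component of `v`, exactly the agents of the list `L` move, each of them to the node of
the next one and the last one into a hole; the list starts at a multinode. -/
structure IsSlide (c : Config AgentState n k) (H : PortGraph (Fin n)) (pos' : Fin k → Fin n)
    (v : Fin n) (L : List (Fin k)) : Prop where
  ne_nil : L ≠ []
  nodup : L.Nodup
  reachable : ∀ j ∈ L, H.graph.Reachable v (c.pos j)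
  isMin : ∀ j ∈ L, c.IsMin j
  head : ∀ j ∈ L.head?, c.IsMultinode (c.pos j)
  stay : ∀ j, H.graph.Reachable v (c.pos j) → j ∉ L → pos' j = c.pos j
  move : ∀ (m : ℕ) (hm : m < L.length), minID (c.idsAt (pos' L[m])) = L[m + 1]?.map agentID

/-- Passes from the list of IDs and ports chosen by `σ` to actual agents and positions; the later
arguments use only `IsSlide`. -/
theorem exists_isSlide (hσ : IsSlidingRule σ) (hid : c.StoresIDs) (hact : c.Active)
    (h1 : c.MultinodeNear H (c.pos i)) (h2 : c.HoleNear H (c.pos i)) :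
    ∃ L, c.IsSlide H ((explicitDispersion σ).round H c).pos (c.pos i) L := by
  have hpos : ∀ j, H.graph.Reachable (c.pos i) (c.pos j) →
      ((explicitDispersion σ).round H c).pos j = moveThrough H (c.pos j)
        (((σ ((explicitDispersion σ).inbox H c i)).find? fun x =>
          decide (x.1 = agentID j)).map Prod.snd) := by
    intro j hr
    rw [← inbox_eq_of_reachable hr]
    obtain ⟨u, hu, hu'⟩ := h1
    obtain ⟨w, hw, hw'⟩ := h2
    exact pos_round_of_near hid hact ⟨u, hr.symm.trans hu, hu'⟩ ⟨w, hr.symm.trans hw, hw'⟩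
  have hP : IsSlidingPath ((explicitDispersion σ).inbox H c i)
      (σ ((explicitDispersion σ).inbox H c i)) := by
    obtain ⟨u, hu, hu'⟩ := h1
    obtain ⟨w, hw, hw'⟩ := h2
    obtain ⟨j, rfl⟩ := hu'.exists_pos_eq
    exact hσ _ (exists_isSlidingPath hid hact hu hu' hw hw')
  generalize hM : (explicitDispersion σ).inbox H c i = M at *
  generalize σ M = P at *
  obtain ⟨hhead, hlead, hnodup⟩ := hP
  have hstep : ∀ (m : ℕ) (hm : m < P.length), ∃ j, agentID j = P[m].1 ∧
      H.graph.Reachable (c.pos i) (c.pos j) ∧ c.IsMin j ∧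
      minID (c.idsAt (moveThrough H (c.pos j) (some P[m].2))) = P[m + 1]?.map Prod.fst := by
    intro m hm
    obtain ⟨S, hS, hmin⟩ := hlead.getElem m hm
    rw [← hM, reported_inbox_getElem? hid hact] at hS
    obtain ⟨j, h1, h2, h3, -, rfl⟩ := hS
    exact ⟨j, h1, h2, h3, hmin⟩
  -- Each ID on the path belongs to a reporting agent, so the list of IDs lifts to a list of agents.
  have hrange : P.map Prod.fst ∈ Set.range (List.map (agentID (k := k))) := by
    rw [Set.range_list_map]
    intro a ha
    obtain ⟨m, hm, rfl⟩ := List.getElem_of_mem ha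
    obtain ⟨j, hj, -⟩ := hstep m (by simpa using hm)
    exact ⟨j, by simpa using hj⟩
  obtain ⟨L, hL⟩ := hrange
  have hlen : L.length = P.length := by simpa using congrArg List.length hL
  have hget : ∀ (m : ℕ) (hm : m < L.length), agentID L[m] = (P[m]'(hlen ▸ hm)).1 := by
    intro m hm
    have : (L.map agentID)[m]'(by simpa using hm) =
        (P.map Prod.fst)[m]'(by simpa [hlen] using hm) := by simp only [hL]
    simpa using this
  have hget? : ∀ m : ℕ, L[m]?.map agentID = P[m]?.map Prod.fst := by
    intro m
    rw [← List.getElem?_map, ← List.getElem?_map, hL]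
  have hmem : ∀ j ∈ L, H.graph.Reachable (c.pos i) (c.pos j) ∧ c.IsMin j := by
    intro j hj
    obtain ⟨m, hm, rfl⟩ := List.getElem_of_mem hj
    obtain ⟨j', hj', h2, h3, -⟩ := hstep m (hlen ▸ hm)
    rw [← hget m hm] at hj'
    exact agentID_injective hj' ▸ ⟨h2, h3⟩
  refine ⟨L, ?_, ?_, fun j hj => (hmem j hj).1, fun j hj => (hmem j hj).2, ?_, ?_, ?_⟩
  · rintro rfl
    exact hlead.ne_nil (List.length_eq_zero_iff.1 hlen.symm)
  · exact List.Nodup.of_map _ (hL ▸ hnodup)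
  · intro j hj
    have : leader M = some (agentID j) := by
      rw [← hhead, List.head?_eq_getElem?, ← hget?, ← List.head?_eq_getElem?, hj]
      rfl
    rw [← hM] at this
    obtain ⟨j', hj', -, -, h⟩ := leader_inbox_eq_some hid this
    exact agentID_injective hj' ▸ h
  · intro j hr hj
    rw [hpos j hr]
    have : P.find? (fun x => decide (x.1 = agentID j)) = none := by
      rw [List.find?_eq_none]
      intro x hx hxj
      have hxL : agentID j ∈ L.map agentID := by
        rw [hL]
        exact List.mem_map.2 ⟨x, hx, by simpa using hxj⟩
      obtain ⟨j', hj', h⟩ := List.mem_map.1 hxL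
      exact hj (agentID_injective h ▸ hj')
    rw [this]
    rfl
  · intro m hm
    obtain ⟨j, hj, hr, -, hmin⟩ := hstep m (hlen ▸ hm)
    rw [← hget m hm] at hj
    obtain rfl := agentID_injective hj
    -- As the IDs on the path are distinct, the lookup by ID returns precisely the `m`-th step.
    have : P.find? (fun x => decide (x.1 = agentID L[m])) = some (P[m]'(hlen ▸ hm)) := by
      cases hf : P.find? (fun x => decide (x.1 = agentID L[m])) with
      | none =>
        have := List.find?_eq_none.1 hf _ (List.getElem_mem (hlen ▸ hm : m < P.length))
        simp [hget m hm] at this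
      | some x =>
        have hx : x.1 = agentID L[m] := by simpa using List.find?_some hf
        rw [hget m hm] at hx
        rw [List.inj_on_of_nodup_map hnodup (List.mem_of_find?_eq_some hf)
          (List.getElem_mem _) hx]
    rw [hpos _ hr, this, hget?]
    exact hmin

/-! ### Effect of a slide on multinodes and occupied nodes -/

namespace IsSlide

variable {pos' : Fin k → Fin n} {v : Fin n} {L : List (Fin k)}

/-- Two path agents never collide, as their successors differ and only the last enters a hole. If a
path agent meets a staying one, the node already held the staying agent and the path agent's
successor. Two staying agents were together before. -/
theorem isMultinode_of_eq (hL : c.IsSlide H pos' v L) {i j : Fin k} (hij : i ≠ j)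
    (hi : H.graph.Reachable v (c.pos i)) (hj : H.graph.Reachable v (c.pos j))
    (h : pos' i = pos' j) : c.IsMultinode (pos' i) := by
  have aux : ∀ {i j : Fin k}, H.graph.Reachable v (c.pos j) → pos' i = pos' j →
      i ∈ L → j ∉ L → c.IsMultinode (pos' i) := by
    intro i j hj h hiL hjL
    obtain ⟨m, hm, rfl⟩ := List.getElem_of_mem hiL
    have hs := hL.stay j hj hjL
    have hmv := hL.move m hm
    cases hnext : L[m + 1]? with
    | none =>
      rw [hnext, Option.map_none, minID_eq_none_iff, idsAt_eq_empty_iff] at hmv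
      exact absurd (hs.symm.trans h.symm) (hmv j)
    | some b =>
      rw [hnext, Option.map_some, minID_idsAt_eq_some_iff] at hmv
      refine isMultinode_iff.2 ⟨b, j, ?_, hmv.1, (h.trans hs).symm⟩
      rintro rfl
      exact hjL (List.mem_of_getElem? hnext)
  by_cases hiL : i ∈ L <;> by_cases hjL : j ∈ L
  · obtain ⟨m, hm, rfl⟩ := List.getElem_of_mem hiL
    obtain ⟨m', hm', rfl⟩ := List.getElem_of_mem hjL
    have hmv := hL.move m hm
    rw [h, hL.move m' hm', ← List.getElem?_map, ← List.getElem?_map] at hmv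
    have hnd : (L.map agentID).Nodup := hL.nodup.map agentID_injective
    exfalso
    apply hij
    -- Equal successors: inside the list this is `Nodup`; if both are `none`, both indices are the
    -- last.
    have hmm : m = m' := by
      by_cases hlt : m + 1 < L.length
      · have := (List.getElem?_inj (by simpa using hlt) hnd).1 hmv.symm
        omega
      · by_cases hlt' : m' + 1 < L.length
        · have := (List.getElem?_inj (by simpa using hlt') hnd).1 hmv
          omega
        · omega
    subst hmm
    rfl
  · exact aux hj h hiL hjL
  · rw [h]
    exact aux hi h.symm hjL hiL
  · rw [hL.stay i hi hiL, hL.stay j hj hjL] at h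
    rw [hL.stay i hi hiL]
    exact isMultinode_iff.2 ⟨i, j, hij, rfl, h.symm⟩

/-- Consider the minimum agent of the node. Off the path, it stays. At the head, the node is a
multinode and a second agent stays, because only minimum agents are on the path. Elsewhere, its
predecessor on the path replaces it. -/
theorem exists_pos_eq (hL : c.IsSlide H pos' v L) (hi : H.graph.Reachable v (c.pos i)) :
    ∃ j, pos' j = c.pos i := by
  obtain ⟨b, hb, hmin⟩ := c.exists_isMin i
  rw [← hb] at hi ⊢
  by_cases hbL : b ∈ L
  · obtain ⟨m, hm, rfl⟩ := List.getElem_of_mem hbL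
    rcases m with _ | m
    · have hmult := hL.head L[0] (by rw [List.head?_eq_getElem?, List.getElem?_eq_getElem hm]; rfl)
      obtain ⟨j, l, hjl, hj, hl⟩ := isMultinode_iff.1 hmult
      obtain ⟨j, hne, hj⟩ : ∃ j, j ≠ L[0] ∧ c.pos j = c.pos L[0] := by
        by_cases h : j = L[0]
        · exact ⟨l, fun h' => hjl (h.trans h'.symm), hl⟩
        · exact ⟨j, h, hj⟩
      have hjL : j ∉ L := fun hjL => hne ((hL.isMin j hjL).eq hmin hj)
      exact ⟨j, (hL.stay j (hj ▸ hi) hjL).trans hj⟩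
    · have hmv := hL.move m (by omega)
      rw [List.getElem?_eq_getElem hm, Option.map_some, minID_idsAt_eq_some_iff] at hmv
      exact ⟨_, hmv.1.symm⟩
  · exact ⟨b, hL.stay b hi hbL⟩

/-- Some agent moves into a hole, and the others move to occupied nodes. -/
theorem exists_hole_filled (hL : c.IsSlide H pos' v L) :
    ∃ j, (∀ l, c.pos l ≠ pos' j) ∧
      ∀ i, H.graph.Reachable v (c.pos i) → pos' i = pos' j ∨ ∃ l, c.pos l = pos' i := by
  have hpos := List.length_pos_iff.2 hL.ne_nil
  have hlast := hL.move (L.length - 1) (by omega)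
  rw [List.getElem?_eq_none (by omega), Option.map_none, minID_eq_none_iff,
    idsAt_eq_empty_iff] at hlast
  refine ⟨_, hlast, fun i hi => ?_⟩
  by_cases hiL : i ∈ L
  · obtain ⟨m, hm, rfl⟩ := List.getElem_of_mem hiL
    by_cases hlt : m + 1 < L.length
    · have hmv := hL.move m hm
      rw [List.getElem?_eq_getElem hlt, Option.map_some, minID_idsAt_eq_some_iff] at hmv
      exact Or.inr ⟨_, hmv.1⟩
    · obtain rfl : m = L.length - 1 := by omega
      exact Or.inl rfl
  · exact Or.inr ⟨i, (hL.stay i hi hiL).symm⟩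

end IsSlide

theorem isMultinode_of_round (hσ : IsSlidingRule σ) (hid : c.StoresIDs) (hact : c.Active)
    {v : Fin n} (hv : ((explicitDispersion σ).round H c).IsMultinode v) : c.IsMultinode v := by
  obtain ⟨i, j, hij, hi, hj⟩ := isMultinode_iff.1 hv
  have hri := reachable_pos_round (σ := σ) (H := H) (i := i) hact
  have hrj := reachable_pos_round (σ := σ) (H := H) (i := j) hact
  rw [hi] at hri
  rw [hj] at hrj
  -- Moves never leave a component, so agents that meet come from the same one and are governed by
  -- the same slide.
  have hr := hri.trans hrj.symm
  by_cases h : c.MultinodeNear H (c.pos i) ∧ c.HoleNear H (c.pos i)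
  · obtain ⟨L, hL⟩ := exists_isSlide hσ hid hact h.1 h.2
    exact hi ▸ hL.isMultinode_of_eq hij (SimpleGraph.Reachable.refl _) hr (hi.trans hj.symm)
  · rw [pos_round_of_not hid hact h] at hi
    have h' : ¬ (c.MultinodeNear H (c.pos j) ∧ c.HoleNear H (c.pos j)) := by
      rintro ⟨⟨u, hu, hu'⟩, ⟨w, hw, hw'⟩⟩
      exact h ⟨⟨u, hr.trans hu, hu'⟩, ⟨w, hr.trans hw, hw'⟩⟩
    rw [pos_round_of_not hid hact h'] at hj
    exact isMultinode_iff.2 ⟨i, j, hij, hi, hj⟩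

theorem exists_pos_round_eq (hσ : IsSlidingRule σ) (hid : c.StoresIDs) (hact : c.Active)
    (H : PortGraph (Fin n)) (i : Fin k) :
    ∃ j, ((explicitDispersion σ).round H c).pos j = c.pos i := by
  by_cases h : c.MultinodeNear H (c.pos i) ∧ c.HoleNear H (c.pos i)
  · obtain ⟨L, hL⟩ := exists_isSlide hσ hid hact h.1 h.2
    exact hL.exists_pos_eq (SimpleGraph.Reachable.refl _)
  · exact ⟨i, pos_round_of_not hid hact h⟩

/-- The occupied nodes. -/
def occupied {State : Type} (c : Config State n k) : Finset (Fin n) := Finset.univ.image c.pos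

theorem mem_occupied {State : Type} {c : Config State n k} {v : Fin n} :
    v ∈ c.occupied ↔ ∃ i, c.pos i = v := by
  simp [occupied]

theorem occupied_subset_round (hσ : IsSlidingRule σ) (hid : c.StoresIDs) (hact : c.Active)
    (H : PortGraph (Fin n)) : c.occupied ⊆ ((explicitDispersion σ).round H c).occupied := by
  intro v hv
  obtain ⟨i, rfl⟩ := mem_occupied.1 hv
  exact mem_occupied.2 (exists_pos_round_eq hσ hid hact H i)

theorem occupied_round_ne (hσ : IsSlidingRule σ) (hid : c.StoresIDs) (hact : c.Active)
    (h1 : c.MultinodeNear H (c.pos i)) (h2 : c.HoleNear H (c.pos i)) :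
    ((explicitDispersion σ).round H c).occupied ≠ c.occupied := by
  obtain ⟨L, hL⟩ := exists_isSlide hσ hid hact h1 h2
  obtain ⟨j, hj, -⟩ := hL.exists_hole_filled
  intro h
  have : ((explicitDispersion σ).round H c).pos j ∈ c.occupied := h ▸ mem_occupied.2 ⟨j, rfl⟩
  obtain ⟨l, hl⟩ := mem_occupied.1 this
  exact hj l hl

/-- On a connected graph at most one hole is filled in a round. -/
theorem card_occupied_round_le (hσ : IsSlidingRule σ) (hid : c.StoresIDs) (hact : c.Active)
    (hH : ∀ u v, H.graph.Reachable u v) :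
    ((explicitDispersion σ).round H c).occupied.card ≤ c.occupied.card + 1 := by
  by_cases h : ∃ i, c.MultinodeNear H (c.pos i) ∧ c.HoleNear H (c.pos i)
  · obtain ⟨i, h1, h2⟩ := h
    obtain ⟨L, hL⟩ := exists_isSlide hσ hid hact h1 h2
    obtain ⟨j, -, hj⟩ := hL.exists_hole_filled
    refine (Finset.card_le_card (t := insert (((explicitDispersion σ).round H c).pos j) c.occupied)
      fun v hv => ?_).trans (Finset.card_insert_le _ _)
    obtain ⟨l, rfl⟩ := mem_occupied.1 hv
    rcases hj l (hH _ _) with h | h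
    · exact Finset.mem_insert.2 (Or.inl h)
    · exact Finset.mem_insert_of_mem (mem_occupied.2 h)
  · push Not at h
    have : ((explicitDispersion σ).round H c).pos = c.pos :=
      funext fun i => pos_round_of_not hid hact fun hi => h i hi.1 hi.2
    simp [occupied, this]

theorem card_occupied_eq_iff {State : Type} {c : Config State n k} :
    c.occupied.card = k ↔ c.Dispersed := by
  have := Finset.card_image_iff (s := Finset.univ) (f := c.pos)
  rw [Finset.card_univ, Fintype.card_fin, Finset.coe_univ, Set.injOn_univ] at this
  exact this

/-! ### Dispersed configurations and memory updates -/

/-- Does not assume `Active`, so it remains available once some agents have terminated. -/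
theorem not_knows_multinode_of_dispersed (hid : c.StoresIDs) (hd : c.Dispersed) :
    ¬ (1 < (c.view H (c.pos i)).here.card ∨
      ∃ m ∈ (explicitDispersion σ).inbox H c i, 1 < m.count) := by
  have hno : ∀ v, ¬ c.IsMultinode v := by
    intro v hv
    exact not_dispersed_iff.2 ⟨v, hv⟩ hd
  rintro (h | ⟨m, hm, h⟩)
  · exact hno _ h
  · obtain ⟨j, -, -, -, rfl⟩ := (mem_inbox_iff hid).1 hm
    exact hno _ h

theorem pos_round_of_dispersed (hid : c.StoresIDs) (hd : c.Dispersed) (H : PortGraph (Fin n)) :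
    ((explicitDispersion σ).round H c).pos = c.pos := by
  funext i
  have h := not_knows_multinode_of_dispersed (σ := σ) (H := H) (i := i) hid hd
  simp only [AgentAlgorithm.round, decision]
  split_ifs
  · rfl
  · simp only [explicitDispersion] at h ⊢
    simp only [if_neg h, moveThrough]

theorem state_round_of_done (hi : (c.state i).done = true) :
    ((explicitDispersion σ).round H c).state i = c.state i := by
  simp [AgentAlgorithm.round, explicitDispersion, hi]

theorem state_round_of_knows (hi : (c.state i).done = false)
    (h : 1 < (c.view H (c.pos i)).here.card ∨
      ∃ m ∈ (explicitDispersion σ).inbox H c i, 1 < m.count) :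
    ((explicitDispersion σ).round H c).state i = { c.state i with t := 0 } := by
  simp only [AgentAlgorithm.round, decision]
  simp only [explicitDispersion] at h ⊢
  simp [hi, h]

theorem state_round_of_not_knows (hi : (c.state i).done = false)
    (h : ¬ (1 < (c.view H (c.pos i)).here.card ∨
      ∃ m ∈ (explicitDispersion σ).inbox H c i, 1 < m.count)) :
    ((explicitDispersion σ).round H c).state i =
      { c.state i with
        t := (c.state i).t + 1
        done := decide ((c.state i).t + 1 = (c.state i).T) } := by
  simp only [AgentAlgorithm.round, decision]
  simp only [explicitDispersion] at h ⊢
  simp [hi, if_neg h]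

end Config

/-! ## Executions -/

namespace Config

open AgentAlgorithm

variable {n k T : ℕ} {σ : List Message → List (ℕ × ℕ)} {G : DynamicGraph (Fin n)}
  {place : Fin k → Fin n}

theorem run_state (hT : 1 ≤ T) (σ : List Message → List (ℕ × ℕ)) (G : DynamicGraph (Fin n))
    (place : Fin k → Fin n) (r : ℕ) (i : Fin k) :
    (((explicitDispersion σ).run T G place r).state i).id = agentID i ∧
    (((explicitDispersion σ).run T G place r).state i).T = T ∧
    (((explicitDispersion σ).run T G place r).state i).t ≤ r ∧
    (((explicitDispersion σ).run T G place r).state i).t ≤ T ∧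
    ((((explicitDispersion σ).run T G place r).state i).done = true ↔
      (((explicitDispersion σ).run T G place r).state i).t = T) := by
  induction r with
  | zero =>
    simp only [run, explicitDispersion]
    refine ⟨trivial, trivial, le_rfl, Nat.zero_le _, ?_⟩
    -- Initially `done` is false and `t = 0`, which differs from `T` because `1 ≤ T`.
    simp
    omega
  | succ r ih =>
    obtain ⟨h1, h2, h3, h4, h5⟩ := ih
    rw [run]
    cases hd : (((explicitDispersion σ).run T G place r).state i).done with
    | true =>
      rw [state_round_of_done hd]
      exact ⟨h1, h2, by omega, h4, h5⟩
    | false =>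
      have hne : (((explicitDispersion σ).run T G place r).state i).t ≠ T := by
        rw [Ne, ← h5, hd]
        simp
      by_cases hk : 1 < ((((explicitDispersion σ).run T G place r).view (G r)
          (((explicitDispersion σ).run T G place r).pos i)).here.card) ∨
          ∃ m ∈ (explicitDispersion σ).inbox (G r) ((explicitDispersion σ).run T G place r) i,
            1 < m.count
      · rw [state_round_of_knows hd hk]
        refine ⟨h1, h2, Nat.zero_le _, Nat.zero_le _, ?_⟩
        simp only [hd]
        simp
        omega
      · rw [state_round_of_not_knows hd hk]
        refine ⟨h1, h2, by simpa using h3, ?_, ?_⟩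
        · change _ + 1 ≤ T
          omega
        · simp [h2]

theorem storesIDs_run (hT : 1 ≤ T) (r : ℕ) :
    ((explicitDispersion σ).run T G place r).StoresIDs :=
  fun i => (run_state hT σ G place r i).1

/-- As long as there is a multinode, every agent was unconnected to it during the rounds that its
counter records. -/
theorem not_reachable_of_counter (hσ : IsSlidingRule σ) (hT : 1 ≤ T) (hG : TPathConnected G T)
    (r : ℕ) :
    (((explicitDispersion σ).run T G place r).Active ∨
      ((explicitDispersion σ).run T G place r).Dispersed) ∧
    ∀ i v, ((explicitDispersion σ).run T G place r).IsMultinode v →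
      ∀ j, r ≤ j + (((explicitDispersion σ).run T G place r).state i).t → j < r →
        ¬ (G j).graph.Reachable (((explicitDispersion σ).run T G place r).pos i) v := by
  suffices h : ∀ i v, ((explicitDispersion σ).run T G place r).IsMultinode v →
      ∀ j, r ≤ j + (((explicitDispersion σ).run T G place r).state i).t → j < r →
        ¬ (G j).graph.Reachable (((explicitDispersion σ).run T G place r).pos i) v by
    refine ⟨or_iff_not_imp_right.2 fun hd i => ?_, h⟩
    obtain ⟨v, hv⟩ := not_dispersed_iff.1 hd
    obtain ⟨-, -, h3, -, h5⟩ := run_state hT σ G place r i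
    by_contra hdone
    have ht := h5.1 (by simpa using hdone)
    -- The subtraction is not truncated: `T = t ≤ r`. All rounds of this window are recorded by the
    -- counter.
    obtain ⟨j, hj, hj', hr⟩ := hG (r - T) (((explicitDispersion σ).run T G place r).pos i) v
    exact h i v hv j (by omega) (by omega) hr
  induction r with
  | zero => intro i v _ j _ hj; omega
  | succ r ih =>
    intro i v hv j hj hjr
    have hid := storesIDs_run (σ := σ) (G := G) (place := place) hT r
    -- A terminated agent would force round `r` to be dispersed, by the induction hypothesis and
    -- connectivity; then nothing moves and `v` could not be a multinode afterwards.
    have hact : ((explicitDispersion σ).run T G place r).Active := by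
      intro i'
      by_contra hdone
      obtain ⟨-, -, h3, -, h5⟩ := run_state hT σ G place r i'
      have ht := h5.1 (by simpa using hdone)
      have hd : ¬ ((explicitDispersion σ).run T G place r).Dispersed := by
        intro hd
        refine not_dispersed_iff.2 ⟨v, hv⟩ ?_
        have := pos_round_of_dispersed (σ := σ) hid hd (G r)
        rw [run, Dispersed, this]
        exact hd
      obtain ⟨u, hu⟩ := not_dispersed_iff.1 hd
      obtain ⟨j, hj, hj', hr⟩ := hG (r - T) (((explicitDispersion σ).run T G place r).pos i') u
      exact ih i' u hu j (by omega) (by omega) hr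
    rw [run] at hv hj ⊢
    have hv' := isMultinode_of_round hσ hid hact hv
    by_cases hk : 1 < ((((explicitDispersion σ).run T G place r).view (G r)
        (((explicitDispersion σ).run T G place r).pos i)).here.card) ∨
        ∃ m ∈ (explicitDispersion σ).inbox (G r) ((explicitDispersion σ).run T G place r) i,
          1 < m.count
    · rw [state_round_of_knows (hact i) hk] at hj
      change r + 1 ≤ j + 0 at hj
      omega
    · rw [state_round_of_not_knows (hact i) hk] at hj
      change r + 1 ≤ j + (_ + 1) at hj
      rw [knows_multinode_iff hid hact] at hk
      -- An agent whose counter grows does not move, so the older rounds are covered by the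
      -- induction hypothesis and the current one by `hk`.
      rw [pos_round_of_not hid hact fun h => hk h.1]
      rcases Nat.lt_succ_iff_lt_or_eq.1 hjr with hlt | rfl
      · exact ih i v hv' j (by omega) hlt
      · exact fun hr => hk ⟨v, hr, hv'⟩

theorem active_of_not_dispersed (hσ : IsSlidingRule σ) (hT : 1 ≤ T) (hG : TPathConnected G T)
    {r : ℕ} (hd : ¬ ((explicitDispersion σ).run T G place r).Dispersed) :
    ((explicitDispersion σ).run T G place r).Active :=
  (not_reachable_of_counter hσ hT hG r).1.resolve_right hd

/-! ### Progress and running time -/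

theorem pos_run_add (hT : 1 ≤ T) {r : ℕ}
    (hd : ((explicitDispersion σ).run T G place r).Dispersed) (s : ℕ) :
    ((explicitDispersion σ).run T G place (r + s)).pos =
      ((explicitDispersion σ).run T G place r).pos := by
  induction s with
  | zero => rfl
  | succ s ih =>
    rw [← add_assoc, run, pos_round_of_dispersed (storesIDs_run hT _), ih]
    rw [Dispersed, ih]
    exact hd

theorem dispersed_run_mono (hT : 1 ≤ T) {r s : ℕ} (hrs : r ≤ s)
    (hd : ((explicitDispersion σ).run T G place r).Dispersed) :
    ((explicitDispersion σ).run T G place s).Dispersed := by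
  obtain ⟨d, rfl⟩ := Nat.exists_eq_add_of_le hrs
  rw [Dispersed, pos_run_add hT hd]
  exact hd

theorem allTerminated_add (hT : 1 ≤ T) {r : ℕ}
    (hd : ((explicitDispersion σ).run T G place r).Dispersed) :
    ((explicitDispersion σ).run T G place (r + T)).AllTerminated (explicitDispersion σ) := by
  intro i
  -- Only a lower bound on `t` holds, as the counter may already be positive at round `r`.
  have key : ∀ s, (((explicitDispersion σ).run T G place (r + s)).state i).done = true ∨
      s ≤ (((explicitDispersion σ).run T G place (r + s)).state i).t := by
    intro s
    induction s with
    | zero => exact Or.inr (Nat.zero_le _)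
    | succ s ih =>
      rw [← add_assoc, run]
      cases hdone : (((explicitDispersion σ).run T G place (r + s)).state i).done with
      | true => exact Or.inl (by rw [state_round_of_done hdone, hdone])
      | false =>
        right
        rw [state_round_of_not_knows hdone (not_knows_multinode_of_dispersed
          (storesIDs_run hT _) (dispersed_run_mono hT (Nat.le_add_right r s) hd))]
        rw [hdone] at ih
        exact Nat.succ_le_succ (ih.resolve_left (by simp))
  change (((explicitDispersion σ).run T G place (r + T)).state i).done = true
  rcases key T with h | h
  · exact h
  · obtain ⟨-, -, -, h4, h5⟩ := run_state hT σ G place (r + T) i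
    exact h5.2 (le_antisymm h4 h)

theorem occupied_run_mono (hσ : IsSlidingRule σ) (hT : 1 ≤ T) (hG : TPathConnected G T) {r s : ℕ}
    (hrs : r ≤ s) : ((explicitDispersion σ).run T G place r).occupied ⊆
      ((explicitDispersion σ).run T G place s).occupied := by
  induction s, hrs using Nat.le_induction with
  | base => exact subset_rfl
  | succ s _ ih =>
    refine ih.trans ?_
    rw [run]
    by_cases hd : ((explicitDispersion σ).run T G place s).Dispersed
    · simp [occupied, pos_round_of_dispersed (storesIDs_run hT s) hd]
    · exact occupied_subset_round hσ (storesIDs_run hT s) (active_of_not_dispersed hσ hT hG hd) _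

theorem isMultinode_of_run (hσ : IsSlidingRule σ) (hT : 1 ≤ T) (hG : TPathConnected G T) {r s : ℕ}
    (hrs : r ≤ s) {v : Fin n} (hv : ((explicitDispersion σ).run T G place s).IsMultinode v) :
    ((explicitDispersion σ).run T G place r).IsMultinode v := by
  induction s, hrs using Nat.le_induction with
  | base => exact hv
  | succ s _ ih =>
    refine ih ?_
    by_cases hd : ((explicitDispersion σ).run T G place s).Dispersed
    · exact absurd (dispersed_run_mono hT (Nat.le_succ s) hd) (not_dispersed_iff.2 ⟨v, hv⟩)
    · rw [run] at hv
      exact isMultinode_of_round hσ (storesIDs_run hT s) (active_of_not_dispersed hσ hT hG hd) hv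

theorem exists_hole {State : Type} {c : Config State n k} (hkn : k ≤ n) (hd : ¬ c.Dispersed) :
    ∃ w, ∀ l, c.pos l ≠ w := by
  by_contra! h
  have hsurj : Function.Surjective c.pos := h
  have hcard : Fintype.card (Fin k) = Fintype.card (Fin n) :=
    le_antisymm (by simpa using hkn) (Fintype.card_le_of_surjective _ hsurj)
  exact hd ((Fintype.bijective_iff_surjective_and_card _).2 ⟨hsurj, hcard⟩).1

/-- In `T` rounds at least one hole is filled. -/
theorem card_occupied_lt (hσ : IsSlidingRule σ) (hT : 1 ≤ T) (hG : TPathConnected G T)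
    (hkn : k ≤ n) {r : ℕ} (hd : ¬ ((explicitDispersion σ).run T G place (r + T)).Dispersed) :
    ((explicitDispersion σ).run T G place r).occupied.card <
      ((explicitDispersion σ).run T G place (r + T)).occupied.card := by
  refine Finset.card_lt_card
    ((occupied_run_mono hσ hT hG (Nat.le_add_right r T)).ssubset_of_ne fun heq => ?_)
  obtain ⟨v, hv⟩ := not_dispersed_iff.1 hd
  obtain ⟨w, hw⟩ := exists_hole hkn hd
  obtain ⟨j, hj, hj', hr⟩ := hG r v w
  -- Multinodes and holes at the end of the window were already such in round `j`, where `v` and `w`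
  -- are connected.
  have hvj := isMultinode_of_run hσ hT hG hj'.le hv
  have hdj := not_dispersed_iff.2 ⟨v, hvj⟩
  have hwj : ∀ l, ((explicitDispersion σ).run T G place j).pos l ≠ w := by
    intro l hl
    have := occupied_run_mono (σ := σ) (place := place) hσ hT hG hj'.le (mem_occupied.2 ⟨l, hl⟩)
    obtain ⟨l', hl'⟩ := mem_occupied.1 this
    exact hw l' hl'
  obtain ⟨i, rfl⟩ := hvj.exists_pos_eq
  refine occupied_round_ne hσ (storesIDs_run hT j) (active_of_not_dispersed hσ hT hG hdj)
    ⟨_, SimpleGraph.Reachable.refl _, hvj⟩ ⟨w, hr, hwj⟩ ?_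
  have h1 := occupied_run_mono (σ := σ) (place := place) hσ hT hG hj
  have h2 := occupied_run_mono (σ := σ) (place := place) hσ hT hG (Nat.le_succ j)
  have h3 := occupied_run_mono (σ := σ) (place := place) hσ hT hG (Nat.succ_le_of_lt hj')
  rw [← heq] at h3
  rw [Nat.succ_eq_add_one, run] at h2 h3
  exact (h3.trans h1).antisymm h2

/-- One node is occupied at the start and each window adds at least one, so `k - 1` windows yield
`k` occupied nodes, that is, dispersion. -/
theorem dispersed_run (hσ : IsSlidingRule σ) (hT : 1 ≤ T) (hG : TPathConnected G T)
    (hk : 1 ≤ k) (hkn : k ≤ n) :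
    ((explicitDispersion σ).run T G place ((k - 1) * T)).Dispersed := by
  by_contra hd
  have key : ∀ m, m ≤ k - 1 →
      m + 1 ≤ ((explicitDispersion σ).run T G place (m * T)).occupied.card := by
    intro m
    induction m with
    | zero =>
      intro _
      exact Finset.card_pos.2 ⟨_, mem_occupied.2 ⟨⟨0, hk⟩, rfl⟩⟩
    | succ m ih =>
      intro hm
      have hd' : ¬ ((explicitDispersion σ).run T G place (m * T + T)).Dispersed := fun h =>
        hd (dispersed_run_mono hT (by rw [← Nat.succ_mul]; exact Nat.mul_le_mul_right T hm) h)
      have := card_occupied_lt hσ hT hG hkn hd'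
      rw [Nat.succ_mul]
      have := ih (by omega)
      omega
  have h1 := key (k - 1) le_rfl
  have h2 : ((explicitDispersion σ).run T G place ((k - 1) * T)).occupied.card ≤ k := by
    simpa [occupied] using Finset.card_image_le (s := (Finset.univ : Finset (Fin k)))
      (f := ((explicitDispersion σ).run T G place ((k - 1) * T)).pos)
  exact hd (card_occupied_eq_iff.1 (by omega))

theorem dispersed_of_terminated (hσ : IsSlidingRule σ) (hT : 1 ≤ T) (hG : TPathConnected G T)
    {r : ℕ} (h : ∃ i, (explicitDispersion σ).terminated
      (((explicitDispersion σ).run T G place r).state i)) :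
    ((explicitDispersion σ).run T G place r).Dispersed := by
  by_contra hd
  obtain ⟨i, hi⟩ := h
  have hi' : (((explicitDispersion σ).run T G place r).state i).done = true := hi
  rw [active_of_not_dispersed hσ hT hG hd i] at hi'
  simp at hi'

theorem allTerminated_run (hσ : IsSlidingRule σ) (hT : 1 ≤ T) (hG : TPathConnected G T)
    (hk : 1 ≤ k) (hkn : k ≤ n) :
    ((explicitDispersion σ).run T G place (k * T)).AllTerminated (explicitDispersion σ) := by
  have := allTerminated_add hT (dispersed_run (place := place) hσ hT hG hk hkn)
  rwa [← Nat.succ_mul, Nat.succ_eq_add_one, Nat.sub_add_cancel hk] at this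

theorem solvesExplicitDispersion (hσ : IsSlidingRule σ) (hT : 1 ≤ T) (hG : TPathConnected G T)
    (hk : 1 ≤ k) (hkn : k ≤ n) (place : Fin k → Fin n) :
    (explicitDispersion σ).SolvesExplicitDispersion T G place :=
  ⟨fun _ => dispersed_of_terminated hσ hT hG, _, allTerminated_run hσ hT hG hk hkn,
    dispersed_of_terminated hσ hT hG ⟨⟨0, hk⟩, allTerminated_run hσ hT hG hk hkn _⟩⟩

/-! ### Memory bound -/

/-- The binary length of a positive `m` is at most `logb 2 x + 1`; the extra bit is absorbed since
`2 ≤ x` gives `1 ≤ logb 2 x`. -/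
theorem size_le_logb {m : ℕ} {x : ℝ} (hx : (m : ℝ) ≤ x) (h2 : 2 ≤ x) :
    (m.size : ℝ) ≤ 2 * Real.logb 2 x := by
  have h1 : 1 ≤ Real.logb 2 x := by
    rw [Real.le_logb_iff_rpow_le (by norm_num) (by linarith)]
    simpa using h2
  rcases Nat.eq_zero_or_pos m.size with h0 | hpos
  · rw [h0]
    push_cast
    linarith
  · have hm : 2 ^ (m.size - 1) ≤ m := Nat.lt_size.1 (by omega)
    have hm' : ((m.size - 1 : ℕ) : ℝ) ≤ Real.logb 2 x := by
      rw [Real.le_logb_iff_rpow_le (by norm_num) (by linarith), Real.rpow_natCast]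
      exact le_trans (by exact_mod_cast hm) hx
    rw [Nat.cast_sub hpos] at hm'
    push_cast at hm'
    linarith

/-- Three numbers at factor `2` each and one flag give the constant `7`. The counter is bounded
because it never exceeds `T`. -/
theorem bits_run_le (hT : 1 ≤ T) (r : ℕ) (i : Fin k) :
    ((((explicitDispersion σ).run T G place r).state i).bits : ℝ) ≤
      7 * Real.logb 2 (max 2 (max (k : ℝ) (T : ℝ))) := by
  obtain ⟨h1, h2, -, h4, -⟩ := run_state hT σ G place r i
  set x : ℝ := max 2 (max (k : ℝ) (T : ℝ))
  have hx2 : 2 ≤ x := le_max_left _ _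
  have hkx : (k : ℝ) ≤ x := (le_max_left _ _).trans (le_max_right _ _)
  have hTx : (T : ℝ) ≤ x := (le_max_right _ _).trans (le_max_right _ _)
  have hlog : 1 ≤ Real.logb 2 x := by
    rw [Real.le_logb_iff_rpow_le (by norm_num) (by linarith)]
    simpa using hx2
  have hi : ((agentID i : ℕ) : ℝ) ≤ x := le_trans (by exact_mod_cast i.isLt) hkx
  have ht : (((((explicitDispersion σ).run T G place r).state i).t : ℕ) : ℝ) ≤ x :=
    le_trans (by exact_mod_cast h4) hTx
  have hs1 := size_le_logb hi hx2
  have hs2 := size_le_logb hTx hx2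
  have hs3 := size_le_logb ht hx2
  unfold AgentState.bits
  rw [h1, h2]
  push_cast
  linarith

end Config

/-! ## A slow dynamic graph -/

open Classical in
/-- Port labels on a finite simple graph. -/
noncomputable def PortGraph.ofGraph {n : ℕ} (Γ : SimpleGraph (Fin n)) : PortGraph (Fin n) where
  graph := Γ
  deg v := Fintype.card (Γ.neighborSet v)
  port v := (Fintype.equivFin (Γ.neighborSet v)).symm

/-- The graph which is complete in the last of every `T` rounds and has no edges otherwise. -/
noncomputable def slowGraph (n T : ℕ) : DynamicGraph (Fin n) := fun r =>
  PortGraph.ofGraph (if r % T = T - 1 then ⊤ else ⊥)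

theorem reachable_slowGraph {n T r : ℕ} (hr : r % T = T - 1) (u v : Fin n) :
    (slowGraph n T r).graph.Reachable u v := by
  simp only [slowGraph, PortGraph.ofGraph, if_pos hr]
  by_cases h : u = v
  · rw [h]
  · exact SimpleGraph.Adj.reachable (by simpa using h)

theorem eq_of_reachable_slowGraph {n T r : ℕ} (hr : r % T ≠ T - 1) {u v : Fin n}
    (h : (slowGraph n T r).graph.Reachable u v) : u = v := by
  simpa [slowGraph, PortGraph.ofGraph, hr] using h

theorem tPathConnected_slowGraph (n : ℕ) {T : ℕ} (hT : 1 ≤ T) :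
    TPathConnected (slowGraph n T) T := by
  intro r u v
  have hlt := Nat.mod_lt r hT
  -- The first round from `r` on whose residue modulo `T` is `T - 1`.
  refine ⟨r + (T - 1 - r % T), by omega, by omega, reachable_slowGraph ?_ u v⟩
  have h := Nat.div_add_mod r T
  have : r + (T - 1 - r % T) = (T - 1) + T * (r / T) := by omega
  rw [this, Nat.add_mul_mod_self_left, Nat.mod_eq_of_lt (by omega)]

namespace Config

open AgentAlgorithm

variable {n k T : ℕ} {σ : List Message → List (ℕ × ℕ)}

/-- `r / T` counts the complete rounds before round `r`. Such a round has a single component and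
hence at most one slide; in edgeless rounds nobody can move. -/
theorem card_occupied_slowGraph_le (hσ : IsSlidingRule σ) (hT : 1 ≤ T) (v : Fin n) (r : ℕ) :
    ((explicitDispersion σ).run T (slowGraph n T) (fun _ : Fin k => v) r).occupied.card ≤
      1 + r / T := by
  have hG := tPathConnected_slowGraph n hT
  induction r with
  | zero =>
    refine (Finset.card_le_card (t := {v}) fun u hu => ?_).trans (by simp)
    obtain ⟨i, rfl⟩ := mem_occupied.1 hu
    exact Finset.mem_singleton_self v
  | succ r ih =>
    rw [run]
    set c := (explicitDispersion σ).run T (slowGraph n T) (fun _ : Fin k => v) r with hc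
    have hmono : r / T ≤ (r + 1) / T := Nat.div_le_div_right (Nat.le_succ r)
    have hid : c.StoresIDs := storesIDs_run hT r
    by_cases hd : c.Dispersed
    · have : ((explicitDispersion σ).round (slowGraph n T r) c).occupied = c.occupied := by
        simp [occupied, pos_round_of_dispersed hid hd]
      rw [this]
      omega
    · have hact : c.Active := active_of_not_dispersed hσ hT hG hd
      by_cases hr : r % T = T - 1
      · have h := card_occupied_round_le hσ hid hact (reachable_slowGraph (n := n) hr)
        have hdiv : (r + 1) / T = r / T + 1 := by
          have h1 := Nat.div_add_mod r T
          have : r + 1 = T * (r / T + 1) := by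
            rw [mul_add, mul_one]
            omega
          conv_lhs => rw [this]
          exact Nat.mul_div_cancel_left _ hT
        omega
      · have hpos : ((explicitDispersion σ).round (slowGraph n T r) c).pos = c.pos :=
          funext fun i => (eq_of_reachable_slowGraph hr (reachable_pos_round hact)).symm
        have : ((explicitDispersion σ).round (slowGraph n T r) c).occupied = c.occupied := by
          simp [occupied, hpos]
        rw [this]
        omega

/-- The bound from dispersion is void for `k = 1`; the bound `T ≤ R`, from the counter having to
reach `T`, covers that case. -/
theorem le_of_allTerminated_slowGraph (hσ : IsSlidingRule σ) (hT : 1 ≤ T) (hk : 1 ≤ k)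
    (v : Fin n) {R : ℕ}
    (hR : ((explicitDispersion σ).run T (slowGraph n T) (fun _ : Fin k => v) R).AllTerminated
      (explicitDispersion σ)) : T ≤ R ∧ (k - 1) * T ≤ R := by
  constructor
  · obtain ⟨-, -, h3, -, h5⟩ := run_state hT σ (slowGraph n T) (fun _ : Fin k => v) R ⟨0, hk⟩
    have := h5.1 (hR ⟨0, hk⟩)
    omega
  · have hd := dispersed_of_terminated hσ hT (tPathConnected_slowGraph n hT)
      ⟨⟨0, hk⟩, hR ⟨0, hk⟩⟩
    have h := card_occupied_slowGraph_le (k := k) hσ hT v R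
    rw [card_occupied_eq_iff.2 hd] at h
    exact (Nat.mul_le_mul_right T (by omega)).trans (Nat.div_mul_le_self R T)

end Config

theorem mainTheorem1 :
    IsSlidingRule shortestSlide ∧
    ∃ c C D : ℝ, 0 < c ∧ 0 < C ∧ 0 < D ∧
      ∀ σ : List Message → List (ℕ × ℕ), IsSlidingRule σ →
      ∀ n k T : ℕ, 1 ≤ k → k ≤ n → 1 ≤ T →
        (∀ G : DynamicGraph (Fin n), TPathConnected G T → ∀ place : Fin k → Fin n,
          (explicitDispersion σ).SolvesExplicitDispersion T G place ∧
          (∃ R : ℕ, (R : ℝ) ≤ C * (k * T) ∧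
            ((explicitDispersion σ).run T G place R).AllTerminated (explicitDispersion σ)) ∧
          (∀ (r : ℕ) (i : Fin k),
            ((((explicitDispersion σ).run T G place r).state i).bits : ℝ) ≤
              D * Real.logb 2 (max 2 (max (k : ℝ) (T : ℝ))))) ∧
        (∃ G : DynamicGraph (Fin n), TPathConnected G T ∧ ∃ place : Fin k → Fin n,
          ∀ R : ℕ,
            ((explicitDispersion σ).run T G place R).AllTerminated (explicitDispersion σ) →
              c * (k * T) ≤ (R : ℝ)) := by
  -- `c = 1 / 2` comes from adding `T ≤ R` and `(k - 1) * T ≤ R`; `C = 1` from `(k - 1) * T` rounds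
  -- to disperse plus `T` to terminate.
  refine ⟨isSlidingRule_shortestSlide, 1 / 2, 1, 7, by norm_num, by norm_num, by norm_num, ?_⟩
  intro σ hσ n k T hk hkn hT
  refine ⟨fun G hG place => ⟨Config.solvesExplicitDispersion hσ hT hG hk hkn place,
    ⟨k * T, by simp, Config.allTerminated_run hσ hT hG hk hkn⟩, Config.bits_run_le hT⟩,
    slowGraph n T, tPathConnected_slowGraph n hT, fun _ => ⟨0, by omega⟩, fun R hR => ?_⟩
  obtain ⟨h1, h2⟩ := Config.le_of_allTerminated_slowGraph hσ hT hk _ hR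
  have hsum : k * T ≤ 2 * R := by
    obtain ⟨k, rfl⟩ := Nat.exists_eq_add_of_le' hk
    rw [Nat.add_sub_cancel] at h2
    rw [add_mul, one_mul]
    omega
  have : (k : ℝ) * T ≤ 2 * R := by exact_mod_cast hsum
  linarith
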